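/- Let $d\ge 0$ and let $\mathbb H^d=\{x\in\mathbb R^d:\|x\|<1\}$ be $d$-dimensional hyperbolic space (curvature $-1$) in the Poincaré ball model, with distance $$d_{\mathbb H}(x,y)=\operatorname{arccosh}\Bigl(1+\frac{2\|x-y\|^2}{(1-\|x\|^2)(1-\|y\|^2)}\Bigr)$$ and Riemannian norm $\|v\|_{\mathbb H}=2\|v\|/(1-\|x\|^2)$ for a tangent vector $v$ at $x$. The length of a smooth path $\gamma:[a,b]\to\mathbb H^d$ is $\operatorname{length}(\gamma)=\int_a^b\|\dot\gamma(t)\|_{\mathbb H}\,dt$. Let $M\subset\mathbb H^d$ be a nonempty totally geodesic submanifold, i.e. $M$ contains every complete geodesic line through two distinct points of $M$. Every $x\in\mathbb H^d$ has a unique closest point $\pi_M(x)$ in $M$. Let $\gamma:[a,b]\to\mathbb H^d$ be a smooth path, or a geodesic segment parametrized by arc length (i.e. $d_{\mathbb H}(\gamma(s),\gamma(t))=|s-t|$ for all $s,t\in[a,b]$). Then $\gamma$ and $\pi_M\circ\gamma$ are smooth, and: 1. If $r\ge 0$ and $d_{\mathbb H}(\gamma(t),M)\ge r$ for all $t\in[a,b]$,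 then $$\operatorname{length}(\pi_M\circ\gamma)\le\frac{1}{\cosh r}\operatorname{length}(\gamma);$$ in particular the shrink factor grows exponentially with $r$: $\operatorname{length}(\pi_M\circ\gamma)\le 2e^{-r}\operatorname{length}(\gamma)$. 2. If $\gamma$ is not constant and not entirely contained in $M$, then $\operatorname{length}(\pi_M\circ\gamma)<\operatorname{length}(\gamma)$. -/

import Mathlib

open scoped ContDiff

noncomputable section

namespace Hyp

/-- The underlying set of the Poincaré ball model of `d`-dimensional hyperbolic space:
the open Euclidean unit ball. -/
def ball (d : ℕ) : Set (EuclideanSpace ℝ (Fin d)) := Metric.ball 0 1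

/-- The hyperbolic distance in the Poincaré ball (curvature `-1`). -/
def hdist {d : ℕ} (x y : EuclideanSpace ℝ (Fin d)) : ℝ :=
  Real.arcosh (1 + 2 * (‖x - y‖ ^ 2 / ((1 - ‖x‖ ^ 2) * (1 - ‖y‖ ^ 2))))

/-- The Riemannian norm of a tangent vector `v` at the point `x` of the Poincaré ball. -/
def tangentNorm {d : ℕ} (x v : EuclideanSpace ℝ (Fin d)) : ℝ :=
  2 * ‖v‖ / (1 - ‖x‖ ^ 2)

/-- A smooth path in hyperbolic space parametrized by `[a, b]`. -/
def IsSmoothPath {d : ℕ} (γ : ℝ → EuclideanSpace ℝ (Fin d)) (a b : ℝ) : Prop :=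
  (∀ t ∈ Set.Icc a b, γ t ∈ ball d) ∧ ContDiffOn ℝ ∞ γ (Set.Icc a b)

/-- The Riemannian length of a path parametrized by `[a, b]`. -/
def length {d : ℕ} (γ : ℝ → EuclideanSpace ℝ (Fin d)) (a b : ℝ) : ℝ :=
  ∫ t in a..b, tangentNorm (γ t) (derivWithin γ (Set.Icc a b) t)

/-- A geodesic segment: a shortest path, parametrized by arc length on `[a, b]`. -/
def IsGeodesicSegment {d : ℕ} (γ : ℝ → EuclideanSpace ℝ (Fin d)) (a b : ℝ) : Prop :=
  (∀ t ∈ Set.Icc a b, γ t ∈ ball d) ∧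
    ∀ s ∈ Set.Icc a b, ∀ t ∈ Set.Icc a b, hdist (γ s) (γ t) = |s - t|

/-- A complete geodesic line, parametrized by arc length. -/
def IsGeodesicLine {d : ℕ} (γ : ℝ → EuclideanSpace ℝ (Fin d)) : Prop :=
  (∀ t, γ t ∈ ball d) ∧ ∀ s t, hdist (γ s) (γ t) = |s - t|

/-- `M` is a (nonempty) totally geodesic submanifold of hyperbolic space: it contains every
geodesic line through two distinct points of it. (In hyperbolic space such a set is
automatically a properly embedded smooth submanifold, so this need not be assumed.) -/
def IsTotallyGeodesic {d : ℕ} (M : Set (EuclideanSpace ℝ (Fin d))) : Prop :=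
  M.Nonempty ∧ M ⊆ ball d ∧
    ∀ γ : ℝ → EuclideanSpace ℝ (Fin d), IsGeodesicLine γ →
      ∀ s t : ℝ, s ≠ t → γ s ∈ M → γ t ∈ M → ∀ u : ℝ, γ u ∈ M

/-- The distance from the point `x` to the set `M`. -/
def distTo {d : ℕ} (x : EuclideanSpace ℝ (Fin d)) (M : Set (EuclideanSpace ℝ (Fin d))) : ℝ :=
  sInf (hdist x '' M)

/-- `y` is a point of `M` closest to `x`. -/
def IsClosestPoint {d : ℕ} (M : Set (EuclideanSpace ℝ (Fin d)))
    (x y : EuclideanSpace ℝ (Fin d)) : Prop :=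
  y ∈ M ∧ ∀ z ∈ M, hdist x y ≤ hdist x z

/-- The closest-point (geodesic) projection onto `M`; it is a closest point whenever there
is one. -/
def proj {d : ℕ} (M : Set (EuclideanSpace ℝ (Fin d))) (x : EuclideanSpace ℝ (Fin d)) :
    EuclideanSpace ℝ (Fin d) :=
  Classical.epsilon (IsClosestPoint M x)

end Hyp

end

/-!
In the hyperboloid model, with the Lorentz form `⟪·,·⟫` of signature `(+, -, …, -)` and
`⟪X, Y⟫ = cosh d(x, y)`, a totally geodesic set is the section of the hyperboloid by a linear
subspace `W`. The Lorentz-orthogonal projection `T` onto `W` gives the closest-point projection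
`π x = T X / √⟪T X, T X⟫`, and `√⟪T X, T X⟫ = cosh d(x, M)`. Splitting `⟪X, Y⟫` along `W ⊕ W^⊥` and
applying the Cauchy–Schwarz inequality on the negative definite `W^⊥` yields

`(cosh d(π x, π y) - 1) * (cosh d(x, M) * cosh d(y, M)) ≤ cosh d(x, y) - 1`.

Since `2 * (cosh d - 1) = d ^ 2 + O(d ^ 4)`, dividing by `(s - t) ^ 2` for `x = γ s`, `y = γ t` and
letting `s → t` shows that `π` shrinks velocities at `x` by the factor `1 / cosh d(x, M)`. If the
lengths of `γ` and `π ∘ γ` agree, then `γ` is stationary whenever it is off `M`, so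
`‖γ - π ∘ γ‖ ^ 2` has derivative zero everywhere.
-/

namespace Hyp

open Set Filter Topology Real

section LorentzForm

variable {V : Type*} [NormedAddCommGroup V] [InnerProductSpace ℝ V]

/-- The Lorentz form of signature `(+, -, …, -)` on `V × ℝ`, the last coordinate being time. -/
noncomputable def lorentz : LinearMap.BilinForm ℝ (V × ℝ) :=
  (LinearMap.mul ℝ ℝ).compl₁₂ (LinearMap.snd ℝ V ℝ) (LinearMap.snd ℝ V ℝ) -
    (innerₗ V).compl₁₂ (LinearMap.fst ℝ V ℝ) (LinearMap.fst ℝ V ℝ)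

lemma lorentz_apply (u v : V × ℝ) : lorentz u v = u.2 * v.2 - inner ℝ u.1 v.1 := rfl

lemma lorentz_self (u : V × ℝ) : lorentz u u = u.2 ^ 2 - ‖u.1‖ ^ 2 := by
  rw [lorentz_apply, real_inner_self_eq_norm_sq, sq u.2]

lemma lorentz_comm (u v : V × ℝ) : lorentz u v = lorentz v u := by
  rw [lorentz_apply, lorentz_apply, real_inner_comm, mul_comm]

lemma lorentz_self_nonneg_iff {u : V × ℝ} : 0 ≤ lorentz u u ↔ ‖u.1‖ ≤ |u.2| := by
  rw [lorentz_self, sub_nonneg, sq_le_sq, abs_norm]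

lemma lorentz_self_pos_iff {u : V × ℝ} : 0 < lorentz u u ↔ ‖u.1‖ < |u.2| := by
  rw [lorentz_self, sub_pos, sq_lt_sq, abs_norm]

lemma eq_zero_of_lorentz_eq_zero {P u : V × ℝ} (hP : 0 < lorentz P P) (hPu : lorentz P u = 0)
    (hu : 0 ≤ lorentz u u) : u = 0 := by
  rw [lorentz_self_pos_iff] at hP
  rw [lorentz_apply, sub_eq_zero] at hPu
  rw [lorentz_self_nonneg_iff] at hu
  have cauchy_schwarz : |P.2| * |u.2| ≤ ‖P.1‖ * |u.2| := by
    rw [← abs_mul, hPu]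
    exact (abs_real_inner_le_norm _ _).trans (by gcongr)
  have snd_eq_zero : u.2 = 0 := by
    by_contra h
    exact hP.not_ge (le_of_mul_le_mul_right cauchy_schwarz (abs_pos.mpr h))
  rw [snd_eq_zero, abs_zero, norm_le_zero_iff] at hu
  exact Prod.ext hu snd_eq_zero

lemma lorentz_self_nonpos_of_lorentz_eq_zero {P u : V × ℝ} (hP : 0 < lorentz P P)
    (hPu : lorentz P u = 0) : lorentz u u ≤ 0 := by
  by_contra! hu
  rw [eq_zero_of_lorentz_eq_zero hP hPu hu.le, map_zero] at hu
  exact hu.false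

lemma lorentz_sq_le_of_lorentz_eq_zero {P u v : V × ℝ} (hP : 0 < lorentz P P)
    (hPu : lorentz P u = 0) (hPv : lorentz P v = 0) :
    lorentz u v ^ 2 ≤ lorentz u u * lorentz v v := by
  let B : LinearMap.BilinForm ℝ (LinearMap.ker (lorentz P)) :=
    (-lorentz).restrict (LinearMap.ker (lorentz P))
  have B_apply (x y) : B x y = -lorentz (x : V × ℝ) y := rfl
  have := B.apply_sq_le_of_symm
    (fun x ↦ neg_nonneg.mpr (lorentz_self_nonpos_of_lorentz_eq_zero hP x.2))
    ⟨fun x y ↦ congrArg Neg.neg (lorentz_comm x.1 y.1)⟩ ⟨u, hPu⟩ ⟨v, hPv⟩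
  simpa only [B_apply, neg_sq, neg_mul_neg] using this

lemma lorentz_smul_add_smul_self (u v : V × ℝ) (α β : ℝ) :
    lorentz (α • u + β • v) (α • u + β • v) =
      α ^ 2 * lorentz u u + 2 * (α * β) * lorentz u v + β ^ 2 * lorentz v v := by
  simp only [map_add, map_smul, LinearMap.add_apply, LinearMap.smul_apply, smul_eq_mul,
    lorentz_comm v u]
  ring

/-- The upper sheet of the unit hyperboloid, a model of hyperbolic space in which the Lorentz form
is the hyperbolic cosine of the distance. -/
def hyperboloid (V : Type*) [NormedAddCommGroup V] [InnerProductSpace ℝ V] : Set (V × ℝ) :=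
  {u | lorentz u u = 1 ∧ 0 < u.2}

lemma lorentz_self_pos_of_mem {u : V × ℝ} (hu : u ∈ hyperboloid V) : 0 < lorentz u u :=
  hu.1 ▸ one_pos

lemma norm_fst_lt_snd {u : V × ℝ} (hu : u ∈ hyperboloid V) : ‖u.1‖ < u.2 :=
  abs_of_pos hu.2 ▸ lorentz_self_pos_iff.mp (lorentz_self_pos_of_mem hu)

lemma one_le_lorentz {u v : V × ℝ} (hu : u ∈ hyperboloid V) (hv : v ∈ hyperboloid V) :
    1 ≤ lorentz u v := by
  have pos : 0 < lorentz u v := sub_pos.mpr <| (real_inner_le_norm _ _).trans_lt <|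
    mul_lt_mul'' (norm_fst_lt_snd hu) (norm_fst_lt_snd hv) (norm_nonneg _) (norm_nonneg _)
  have := lorentz_self_nonpos_of_lorentz_eq_zero (u := v - lorentz u v • u)
    (lorentz_self_pos_of_mem hu) (by simp [hu.1])
  simp only [map_sub, map_smul, LinearMap.sub_apply, LinearMap.smul_apply, smul_eq_mul,
    lorentz_comm v u, hu.1, hv.1] at this
  nlinarith

lemma eq_of_lorentz_le_one {u v : V × ℝ} (hu : u ∈ hyperboloid V) (hv : v ∈ hyperboloid V)
    (h : lorentz u v ≤ 1) : u = v := by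
  have eq_one : lorentz u v = 1 := h.antisymm (one_le_lorentz hu hv)
  have := eq_zero_of_lorentz_eq_zero (u := v - u) (lorentz_self_pos_of_mem hu)
    (by simp [hu.1, eq_one]) (by simp [hu.1, hv.1, eq_one, lorentz_comm v u])
  exact (sub_eq_zero.mp this).symm

lemma snd_pos_of_lorentz_pos {P u : V × ℝ} (hP : P ∈ hyperboloid V) (hu : 0 ≤ lorentz u u)
    (hPu : 0 < lorentz P u) : 0 < u.2 := by
  by_contra! hu2
  rw [lorentz_self_nonneg_iff, abs_of_nonpos hu2] at hu
  have : -inner ℝ P.1 u.1 ≤ P.2 * -u.2 := (neg_le_abs _).trans <|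
    (abs_real_inner_le_norm _ _).trans <|
      mul_le_mul (norm_fst_lt_snd hP).le hu (norm_nonneg _) hP.2.le
  rw [lorentz_apply] at hPu
  linarith

lemma inv_sqrt_smul_mem_hyperboloid {P u : V × ℝ} (hP : P ∈ hyperboloid V)
    (hu : 0 < lorentz u u) (hPu : 0 < lorentz P u) :
    (√(lorentz u u))⁻¹ • u ∈ hyperboloid V := by
  have := sqrt_pos.mpr hu
  refine ⟨?_, mul_pos (inv_pos.mpr this) (snd_pos_of_lorentz_pos hP hu.le hPu)⟩
  simp only [map_smul, LinearMap.smul_apply, smul_eq_mul]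
  rw [← mul_assoc, ← mul_inv, mul_self_sqrt hu.le, inv_mul_cancel₀ hu.ne']

/-- A set of points of the hyperboloid containing every point of the hyperboloid that lies in the
plane spanned by two of its points: the form that total geodesicity takes in this model. -/
def IsLineClosed (S : Set (V × ℝ)) : Prop :=
  ∀ X ∈ S, ∀ Y ∈ S, ∀ α β : ℝ, α • X + β • Y ∈ hyperboloid V → α • X + β • Y ∈ S

namespace IsLineClosed

variable {S : Set (V × ℝ)}

lemma exists_smul_add_smul_eq (hS : IsLineClosed S) (hSV : S ⊆ hyperboloid V) {X Y : V × ℝ}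
    (hX : X ∈ S) (hY : Y ∈ S) {α β : ℝ} (hα : 0 < α) (hβ : 0 < β) :
    ∃ c : ℝ, 0 < c ∧ ∃ Z ∈ S, α • X + β • Y = c • Z := by
  set u := α • X + β • Y with hu
  have one_le := one_le_lorentz (hSV hX) (hSV hY)
  have timelike : 0 < lorentz u u := by
    rw [lorentz_smul_add_smul_self, (hSV hX).1, (hSV hY).1]
    positivity
  have future : 0 < lorentz X u := by
    simp only [hu, map_add, map_smul, smul_eq_mul, (hSV hX).1]
    positivity
  have mem := inv_sqrt_smul_mem_hyperboloid (hSV hX) timelike future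
  refine ⟨√(lorentz u u), sqrt_pos.mpr timelike, (√(lorentz u u))⁻¹ • u, ?_,
    (smul_inv_smul₀ (sqrt_pos.mpr timelike).ne' u).symm⟩
  rw [hu, smul_add, smul_smul, smul_smul] at mem ⊢
  exact hS X hX Y hY _ _ mem

lemma exists_eq_smul_sub_smul_of_mem_span (hS : IsLineClosed S) (hSV : S ⊆ hyperboloid V)
    (hne : S.Nonempty) {w : V × ℝ} (hw : w ∈ Submodule.span ℝ S) :
    ∃ α β : ℝ, 0 < α ∧ 0 < β ∧ ∃ X ∈ S, ∃ Y ∈ S, w = α • X - β • Y := by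
  -- The open cone over `S` is closed under addition, so its differences form a subspace.
  obtain ⟨P, hP⟩ := hne
  have zero : ∃ α β : ℝ, 0 < α ∧ 0 < β ∧ ∃ X ∈ S, ∃ Y ∈ S, (0 : V × ℝ) = α • X - β • Y :=
    ⟨1, 1, one_pos, one_pos, P, hP, P, hP, (sub_self _).symm⟩
  induction hw using Submodule.span_induction with
  | mem X hX => exact ⟨2, 1, two_pos, one_pos, X, hX, X, hX, by module⟩
  | zero => exact zero
  | add _ _ _ _ h h' =>
    obtain ⟨α, β, hα, hβ, X, hX, Y, hY, rfl⟩ := h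
    obtain ⟨α', β', hα', hβ', X', hX', Y', hY', rfl⟩ := h'
    obtain ⟨c, hc, Z, hZ, hcZ⟩ := hS.exists_smul_add_smul_eq hSV hX hX' hα hα'
    obtain ⟨c', hc', Z', hZ', hcZ'⟩ := hS.exists_smul_add_smul_eq hSV hY hY' hβ hβ'
    exact ⟨c, c', hc, hc', Z, hZ, Z', hZ', by rw [← hcZ, ← hcZ']; abel⟩
  | smul c _ _ h =>
    obtain ⟨α, β, hα, hβ, X, hX, Y, hY, rfl⟩ := h
    rcases lt_trichotomy c 0 with hc | rfl | hc
    · exact ⟨-c * β, -c * α, mul_pos (neg_pos.mpr hc) hβ, mul_pos (neg_pos.mpr hc) hα,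
        Y, hY, X, hX, by module⟩
    · rwa [zero_smul]
    · exact ⟨c * α, c * β, mul_pos hc hα, mul_pos hc hβ, X, hX, Y, hY, by module⟩

lemma mem_of_mem_span (hS : IsLineClosed S) (hSV : S ⊆ hyperboloid V) (hne : S.Nonempty)
    {u : V × ℝ} (hu : u ∈ hyperboloid V) (hspan : u ∈ Submodule.span ℝ S) : u ∈ S := by
  obtain ⟨α, β, -, -, X, hX, Y, hY, rfl⟩ := hS.exists_eq_smul_sub_smul_of_mem_span hSV hne hspan
  rw [sub_eq_add_neg, ← neg_smul] at hu ⊢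
  exact hS X hX Y hY _ _ hu

end IsLineClosed

end LorentzForm

section TimelikeProjection

variable {V : Type*} [NormedAddCommGroup V] [InnerProductSpace ℝ V]
  {T : (V × ℝ) →L[ℝ] (V × ℝ)} {u v : V × ℝ}

/-- `T` is a Lorentz-orthogonal projection whose range meets the hyperboloid, so that the
complement of its range is negative definite. -/
structure IsTimelikeProjection (T : (V × ℝ) →L[ℝ] (V × ℝ)) : Prop where
  map_map : ∀ u, T (T u) = T u
  lorentz_map_left : ∀ u v, lorentz (T u) v = lorentz u (T v)
  exists_fixed : ∃ P ∈ hyperboloid V, T P = P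

lemma exists_isTimelikeProjection [FiniteDimensional ℝ V] (W : Submodule ℝ (V × ℝ)) {P : V × ℝ}
    (hP : P ∈ hyperboloid V) (hPW : P ∈ W) :
    ∃ T : (V × ℝ) →L[ℝ] (V × ℝ), IsTimelikeProjection T ∧ ∀ u, T u = u ↔ u ∈ W := by
  have isRefl : (lorentz (V := V)).IsRefl := fun u v h ↦ by rw [lorentz_comm, h]
  have separating (w : W) (hw : ∀ y : W, lorentz (w : V × ℝ) y = 0) : w = 0 :=
    Subtype.ext <| eq_zero_of_lorentz_eq_zero (lorentz_self_pos_of_mem hP)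
      (by rw [lorentz_comm]; exact hw ⟨P, hPW⟩) (hw w).ge
  have nondegenerate : ((lorentz (V := V)).restrict W).Nondegenerate :=
    ⟨separating, fun w hw ↦ separating w fun y ↦ by rw [lorentz_comm]; exact hw y⟩
  have isCompl := LinearMap.BilinForm.isCompl_orthogonal_of_restrict_nondegenerate isRefl
    nondegenerate
  let T : (V × ℝ) →L[ℝ] (V × ℝ) := LinearMap.toContinuousLinearMap (W.projection _ isCompl)
  have map_mem (u) : T u ∈ W := Submodule.projection_apply_mem isCompl u
  have map_of_mem {u} (hu : u ∈ W) : T u = u := Submodule.projection_apply_of_mem_left isCompl hu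
  have lorentz_map_map (u v) : lorentz (T u) v = lorentz (T u) (T v) :=
    sub_eq_zero.mp <| by
      rw [← map_sub]
      exact Submodule.sub_projection_mem isCompl v (T u) (map_mem u)
  refine ⟨T, ⟨fun u ↦ map_of_mem (map_mem u), fun u v ↦ ?_, P, hP, map_of_mem hPW⟩,
    fun u ↦ ⟨fun h ↦ h ▸ map_mem u, map_of_mem⟩⟩
  rw [lorentz_map_map, lorentz_comm, ← lorentz_map_map, lorentz_comm]

/-- For `u` on the hyperboloid, the hyperbolic cosine of the distance from `u` to the subspace
fixed by `T`. -/
noncomputable def coshDist (T : (V × ℝ) →L[ℝ] (V × ℝ)) (u : V × ℝ) : ℝ := √(lorentz (T u) (T u))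

/-- The foot of the perpendicular from `u` to the part of the hyperboloid fixed by `T`, obtained by
rescaling `T u`. -/
noncomputable def foot (T : (V × ℝ) →L[ℝ] (V × ℝ)) (u : V × ℝ) : V × ℝ := (coshDist T u)⁻¹ • T u

namespace IsTimelikeProjection

lemma lorentz_eq_add (hT : IsTimelikeProjection T) (u v : V × ℝ) :
    lorentz u v = lorentz (T u) (T v) + lorentz (u - T u) (v - T v) := by
  have tangential : lorentz (T u) (T v) = lorentz u (T v) := by
    rw [hT.lorentz_map_left, hT.map_map]
  simp only [map_sub, LinearMap.sub_apply, tangential, hT.lorentz_map_left]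
  ring

lemma exists_timelike_lorentz_sub_map_eq_zero (hT : IsTimelikeProjection T) :
    ∃ P : V × ℝ, 0 < lorentz P P ∧ ∀ u, lorentz P (u - T u) = 0 := by
  obtain ⟨P, hP, hTP⟩ := hT.exists_fixed
  exact ⟨P, lorentz_self_pos_of_mem hP, fun u ↦ by
    rw [map_sub, ← hT.lorentz_map_left, hTP, sub_self]⟩

lemma one_le_lorentz_map (hT : IsTimelikeProjection T) (hu : u ∈ hyperboloid V) :
    1 ≤ lorentz (T u) (T u) := by
  obtain ⟨P, hP, horth⟩ := hT.exists_timelike_lorentz_sub_map_eq_zero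
  linarith [hT.lorentz_eq_add u u, lorentz_self_nonpos_of_lorentz_eq_zero hP (horth u), hu.1]

lemma one_le_coshDist (hT : IsTimelikeProjection T) (hu : u ∈ hyperboloid V) : 1 ≤ coshDist T u :=
  one_le_sqrt.mpr (hT.one_le_lorentz_map hu)

lemma coshDist_pos (hT : IsTimelikeProjection T) (hu : u ∈ hyperboloid V) : 0 < coshDist T u :=
  one_pos.trans_le (hT.one_le_coshDist hu)

lemma coshDist_sq (hT : IsTimelikeProjection T) (hu : u ∈ hyperboloid V) :
    coshDist T u ^ 2 = lorentz (T u) (T u) :=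
  sq_sqrt (zero_le_one.trans (hT.one_le_lorentz_map hu))

lemma coshDist_smul_foot (hT : IsTimelikeProjection T) (hu : u ∈ hyperboloid V) :
    coshDist T u • foot T u = T u :=
  smul_inv_smul₀ (hT.coshDist_pos hu).ne' _

lemma map_foot (hT : IsTimelikeProjection T) (u : V × ℝ) : T (foot T u) = foot T u := by
  rw [foot, map_smul, hT.map_map]

lemma foot_mem (hT : IsTimelikeProjection T) (hu : u ∈ hyperboloid V) :
    foot T u ∈ hyperboloid V := by
  obtain ⟨P, hP, hTP⟩ := hT.exists_fixed
  refine inv_sqrt_smul_mem_hyperboloid hP (one_pos.trans_le (hT.one_le_lorentz_map hu)) ?_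
  rw [← hT.lorentz_map_left, hTP]
  exact one_pos.trans_le (one_le_lorentz hP hu)

lemma lorentz_eq_coshDist_mul (hT : IsTimelikeProjection T) (hu : u ∈ hyperboloid V)
    (hv : T v = v) : lorentz u v = coshDist T u * lorentz (foot T u) v := by
  rw [← smul_eq_mul, ← LinearMap.smul_apply, ← map_smul, hT.coshDist_smul_foot hu,
    hT.lorentz_map_left, hv]

lemma lorentz_foot (hT : IsTimelikeProjection T) (hu : u ∈ hyperboloid V) :
    lorentz u (foot T u) = coshDist T u := by
  rw [hT.lorentz_eq_coshDist_mul hu (hT.map_foot u), (hT.foot_mem hu).1, mul_one]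

lemma one_sub_coshDist_mul_le (hT : IsTimelikeProjection T) (hu : u ∈ hyperboloid V)
    (hv : v ∈ hyperboloid V) :
    1 - coshDist T u * coshDist T v ≤ lorentz (u - T u) (v - T v) := by
  obtain ⟨P, hP, horth⟩ := hT.exists_timelike_lorentz_sub_map_eq_zero
  have lorentz_normal {w : V × ℝ} (hw : w ∈ hyperboloid V) :
      lorentz (w - T w) (w - T w) = 1 - coshDist T w ^ 2 := by
    linarith [hT.lorentz_eq_add w w, hw.1, hT.coshDist_sq hw]
  have one_le : 1 ≤ coshDist T u * coshDist T v :=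
    one_le_mul_of_one_le_of_one_le (hT.one_le_coshDist hu) (hT.one_le_coshDist hv)
  have sq_le : lorentz (u - T u) (v - T v) ^ 2 ≤ (coshDist T u * coshDist T v - 1) ^ 2 :=
    calc lorentz (u - T u) (v - T v) ^ 2
      _ ≤ (1 - coshDist T u ^ 2) * (1 - coshDist T v ^ 2) := by
        rw [← lorentz_normal hu, ← lorentz_normal hv]
        exact lorentz_sq_le_of_lorentz_eq_zero hP (horth u) (horth v)
      _ ≤ (coshDist T u * coshDist T v - 1) ^ 2 := by
        linarith [sq_nonneg (coshDist T u - coshDist T v)]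
  linarith [abs_le.mp (abs_le_of_sq_le_sq sq_le (sub_nonneg.mpr one_le))]

lemma lorentz_foot_foot_sub_one_mul_le (hT : IsTimelikeProjection T) (hu : u ∈ hyperboloid V)
    (hv : v ∈ hyperboloid V) :
    (lorentz (foot T u) (foot T v) - 1) * (coshDist T u * coshDist T v) ≤ lorentz u v - 1 := by
  have tangential : lorentz (T u) (T v) =
      coshDist T u * coshDist T v * lorentz (foot T u) (foot T v) := by
    rw [← hT.coshDist_smul_foot hu, ← hT.coshDist_smul_foot hv]
    simp only [map_smul, LinearMap.smul_apply, smul_eq_mul]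
    ring
  linarith [hT.lorentz_eq_add u v, hT.one_sub_coshDist_mul_le hu hv]

lemma contDiffOn_coshDist (hT : IsTimelikeProjection T) {n : WithTop ℕ∞} :
    ContDiffOn ℝ n (coshDist T) (hyperboloid V) := by
  have smooth : ContDiff ℝ n fun u ↦ lorentz (T u) (T u) := by
    simp only [lorentz_self]
    exact (T.contDiff.snd.pow 2).sub (T.contDiff.fst.norm_sq ℝ)
  exact smooth.contDiffOn.sqrt fun u hu ↦ (one_pos.trans_le (hT.one_le_lorentz_map hu)).ne'

lemma contDiffOn_foot (hT : IsTimelikeProjection T) {n : WithTop ℕ∞} :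
    ContDiffOn ℝ n (foot T) (hyperboloid V) :=
  (hT.contDiffOn_coshDist.inv fun _ hu ↦ (hT.coshDist_pos hu).ne').smul T.contDiff.contDiffOn

end IsTimelikeProjection

end TimelikeProjection

section HyperbolicLine

variable {V : Type*} [NormedAddCommGroup V] [InnerProductSpace ℝ V] {X Y U Z : V × ℝ}

/-- `U` is a unit tangent vector to the hyperboloid at `X`. -/
structure IsUnitTangent (X U : V × ℝ) : Prop where
  mem : X ∈ hyperboloid V
  lorentz_eq_zero : lorentz X U = 0
  lorentz_self_eq : lorentz U U = -1

/-- The geodesic on the hyperboloid that starts at `X` with velocity `U`, a unit tangent vector. -/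
noncomputable def hyperbolicLine (X U : V × ℝ) (t : ℝ) : V × ℝ := cosh t • X + sinh t • U

lemma contDiff_hyperbolicLine {n : WithTop ℕ∞} : ContDiff ℝ n (hyperbolicLine X U) :=
  (contDiff_cosh.smul contDiff_const).add (contDiff_sinh.smul contDiff_const)

namespace IsUnitTangent

lemma lorentz_hyperbolicLine (h : IsUnitTangent X U) (s t : ℝ) :
    lorentz (hyperbolicLine X U s) (hyperbolicLine X U t) = cosh (s - t) := by
  simp only [hyperbolicLine, map_add, map_smul, LinearMap.add_apply, LinearMap.smul_apply,
    smul_eq_mul, lorentz_comm U X, h.mem.1, h.lorentz_eq_zero, h.lorentz_self_eq, cosh_sub]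
  ring

lemma hyperbolicLine_mem (h : IsUnitTangent X U) (t : ℝ) :
    hyperbolicLine X U t ∈ hyperboloid V := by
  have unit : lorentz (hyperbolicLine X U t) (hyperbolicLine X U t) = 1 := by
    rw [h.lorentz_hyperbolicLine, sub_self, cosh_zero]
  refine ⟨unit, snd_pos_of_lorentz_pos h.mem (unit ▸ zero_le_one) ?_⟩
  simpa [hyperbolicLine, h.mem.1, h.lorentz_eq_zero] using cosh_pos t

lemma eq_hyperbolicLine_arsinh (h : IsUnitTangent X U) {a b : ℝ}
    (hZ : a • X + b • U ∈ hyperboloid V) : a • X + b • U = hyperbolicLine X U (arsinh b) := by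
  have a_pos : 0 < a := by
    have := one_le_lorentz h.mem hZ
    simp only [map_add, map_smul, smul_eq_mul, h.mem.1, h.lorentz_eq_zero] at this
    linarith
  have a_eq : √(1 + b ^ 2) = a := by
    have := hZ.1
    rw [lorentz_smul_add_smul_self, h.mem.1, h.lorentz_eq_zero, h.lorentz_self_eq] at this
    rw [show 1 + b ^ 2 = a ^ 2 by linarith, sqrt_sq a_pos.le]
  rw [hyperbolicLine, cosh_arsinh, sinh_arsinh, a_eq]

end IsUnitTangent

lemma exists_isUnitTangent (hX : X ∈ hyperboloid V) (hY : Y ∈ hyperboloid V) {r : ℝ} (hr : r ≠ 0)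
    (hXY : lorentz X Y = cosh r) :
    ∃ U, IsUnitTangent X U ∧ hyperbolicLine X U r = Y := by
  have sinh_ne : sinh r ≠ 0 := sinh_eq_zero.not.mpr hr
  have unit : lorentz (Y - cosh r • X) (Y - cosh r • X) = -sinh r ^ 2 := by
    simp only [map_sub, map_smul, LinearMap.sub_apply, LinearMap.smul_apply, smul_eq_mul,
      lorentz_comm Y X, hX.1, hY.1, hXY]
    linarith [cosh_sq r]
  refine ⟨(sinh r)⁻¹ • (Y - cosh r • X), ⟨hX, by simp [hX.1, hXY], ?_⟩, ?_⟩
  · rw [map_smul, LinearMap.map_smul₂, unit, smul_eq_mul, smul_eq_mul]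
    field_simp
  · rw [hyperbolicLine, smul_inv_smul₀ sinh_ne, add_sub_cancel]

lemma exists_forall_eq_hyperbolicLine {Γ : ℝ → V × ℝ} {S : Set ℝ}
    (hΓ : ∀ t ∈ S, Γ t ∈ hyperboloid V)
    (hΓΓ : ∀ s ∈ S, ∀ t ∈ S, lorentz (Γ s) (Γ t) = cosh (s - t))
    {a b : ℝ} (ha : a ∈ S) (hb : b ∈ S) (hab : a ≠ b) :
    ∃ U, IsUnitTangent (Γ a) U ∧ ∀ t ∈ S, Γ t = hyperbolicLine (Γ a) U (t - a) := by
  obtain ⟨U, hU, hUb⟩ := exists_isUnitTangent (hΓ a ha) (hΓ b hb) (sub_ne_zero.mpr hab.symm)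
    (by rw [hΓΓ a ha b hb, ← cosh_neg, neg_sub])
  refine ⟨U, hU, fun t ht ↦ eq_of_lorentz_le_one (hΓ t ht) (hU.hyperbolicLine_mem _) ?_⟩
  have lorentz_U : lorentz (Γ t) U = -sinh (t - a) := by
    have h := hΓΓ t ht b hb
    rw [← hUb, hyperbolicLine, map_add, map_smul, map_smul, smul_eq_mul, smul_eq_mul,
      hΓΓ t ht a ha, ← sub_sub_sub_cancel_right t b a, cosh_sub (t - a)] at h
    exact mul_left_cancel₀ (sinh_eq_zero.not.mpr (sub_ne_zero.mpr hab.symm)) (by linarith)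
  rw [hyperbolicLine, map_add, map_smul, map_smul, smul_eq_mul, smul_eq_mul, lorentz_U,
    hΓΓ t ht a ha]
  linarith [cosh_sq (t - a)]

end HyperbolicLine

section StereographicProjection

lemma one_sub_norm_sq_pos {E : Type*} [SeminormedAddCommGroup E] {x : E}
    (hx : x ∈ Metric.ball 0 1) : 0 < 1 - ‖x‖ ^ 2 := by
  rw [mem_ball_zero_iff] at hx
  exact sub_pos.mpr (pow_lt_one₀ (norm_nonneg x) hx two_ne_zero)

variable {V : Type*} [NormedAddCommGroup V] [InnerProductSpace ℝ V] {x y : V} {u : V × ℝ}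

/-- The isometry from the Poincaré ball to the hyperboloid; its inverse is `ofHyperboloid`. -/
noncomputable def toHyperboloid (x : V) : V × ℝ :=
  ((2 / (1 - ‖x‖ ^ 2)) • x, (1 + ‖x‖ ^ 2) / (1 - ‖x‖ ^ 2))

/-- The stereographic projection from the hyperboloid to the Poincaré ball. -/
noncomputable def ofHyperboloid (u : V × ℝ) : V := (1 + u.2)⁻¹ • u.1

lemma lorentz_toHyperboloid (hx : x ∈ Metric.ball 0 1) (hy : y ∈ Metric.ball 0 1) :
    lorentz (toHyperboloid x) (toHyperboloid y) =
      1 + 2 * (‖x - y‖ ^ 2 / ((1 - ‖x‖ ^ 2) * (1 - ‖y‖ ^ 2))) := by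
  have := one_sub_norm_sq_pos hx
  have := one_sub_norm_sq_pos hy
  simp only [lorentz_apply, toHyperboloid, real_inner_smul_left, real_inner_smul_right,
    norm_sub_sq_real]
  field_simp
  ring

lemma toHyperboloid_mem (hx : x ∈ Metric.ball 0 1) : toHyperboloid x ∈ hyperboloid V :=
  ⟨by simp [lorentz_toHyperboloid hx hx], div_pos (by positivity) (one_sub_norm_sq_pos hx)⟩

lemma one_sub_norm_ofHyperboloid_sq (hu : u ∈ hyperboloid V) :
    1 - ‖ofHyperboloid u‖ ^ 2 = 2 / (1 + u.2) := by
  have unit := hu.1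
  have := hu.2
  rw [lorentz_self] at unit
  rw [ofHyperboloid, norm_smul, mul_pow, norm_eq_abs, sq_abs,
    show ‖u.1‖ ^ 2 = (u.2 - 1) * (1 + u.2) by linarith]
  field_simp
  ring

lemma ofHyperboloid_mem (hu : u ∈ hyperboloid V) : ofHyperboloid u ∈ Metric.ball (0 : V) 1 := by
  have : 0 < 2 / (1 + u.2) := div_pos two_pos (add_pos one_pos hu.2)
  rw [← one_sub_norm_ofHyperboloid_sq hu, sub_pos] at this
  exact mem_ball_zero_iff.mpr ((sq_lt_one_iff₀ (norm_nonneg _)).mp this)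

lemma ofHyperboloid_toHyperboloid (hx : x ∈ Metric.ball 0 1) :
    ofHyperboloid (toHyperboloid x) = x := by
  have := one_sub_norm_sq_pos hx
  rw [ofHyperboloid, toHyperboloid, smul_smul]
  convert! one_smul ℝ x
  field_simp
  ring

lemma toHyperboloid_ofHyperboloid (hu : u ∈ hyperboloid V) :
    toHyperboloid (ofHyperboloid u) = u := by
  have := hu.2
  have norm_sq : ‖ofHyperboloid u‖ ^ 2 = 1 - 2 / (1 + u.2) := by
    linarith [one_sub_norm_ofHyperboloid_sq hu]
  rw [toHyperboloid, one_sub_norm_ofHyperboloid_sq hu, norm_sq, ofHyperboloid,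
    div_div_cancel₀ two_ne_zero, smul_inv_smul₀ (by positivity)]
  refine Prod.ext rfl ?_
  field_simp
  ring

lemma toHyperboloid_injOn : InjOn toHyperboloid (Metric.ball (0 : V) 1) :=
  LeftInvOn.injOn fun _ ↦ ofHyperboloid_toHyperboloid

lemma contDiffOn_toHyperboloid {n : WithTop ℕ∞} :
    ContDiffOn ℝ n toHyperboloid (Metric.ball (0 : V) 1) := by
  have hnorm : ContDiffOn ℝ n (fun x : V ↦ ‖x‖ ^ 2) (Metric.ball 0 1) := contDiffOn_id.norm_sq ℝ
  have hden := contDiffOn_const (c := (1 : ℝ)).sub hnorm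
  have hden_ne (x : V) (hx : x ∈ Metric.ball 0 1) := (one_sub_norm_sq_pos hx).ne'
  exact ((contDiffOn_const.div hden hden_ne).smul contDiffOn_id).prodMk
    ((contDiffOn_const.add hnorm).div hden hden_ne)

lemma contDiffOn_ofHyperboloid {n : WithTop ℕ∞} :
    ContDiffOn ℝ n ofHyperboloid (hyperboloid V) :=
  ((contDiffOn_const.add contDiffOn_snd).inv fun _ hu ↦ (add_pos one_pos hu.2).ne').smul
    contDiffOn_fst

end StereographicProjection

section PoincareBall

variable {d : ℕ} {M : Set (EuclideanSpace ℝ (Fin d))} {x y : EuclideanSpace ℝ (Fin d)}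

lemma hdist_eq_arcosh_lorentz (hx : x ∈ ball d) (hy : y ∈ ball d) :
    hdist x y = arcosh (lorentz (toHyperboloid x) (toHyperboloid y)) := by
  rw [lorentz_toHyperboloid hx hy, hdist]

lemma cosh_hdist (hx : x ∈ ball d) (hy : y ∈ ball d) :
    cosh (hdist x y) = lorentz (toHyperboloid x) (toHyperboloid y) := by
  rw [hdist_eq_arcosh_lorentz hx hy,
    cosh_arcosh (one_le_lorentz (toHyperboloid_mem hx) (toHyperboloid_mem hy))]

lemma hdist_le_hdist_iff (hx : x ∈ ball d) (hy : y ∈ ball d) {z : EuclideanSpace ℝ (Fin d)}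
    (hz : z ∈ ball d) :
    hdist x y ≤ hdist x z ↔
      lorentz (toHyperboloid x) (toHyperboloid y) ≤
        lorentz (toHyperboloid x) (toHyperboloid z) := by
  have pos {w} (hw : w ∈ ball d) : 0 < lorentz (toHyperboloid x) (toHyperboloid w) :=
    one_pos.trans_le (one_le_lorentz (toHyperboloid_mem hx) (toHyperboloid_mem hw))
  rw [hdist_eq_arcosh_lorentz hx hy, hdist_eq_arcosh_lorentz hx hz,
    arcosh_le_arcosh (pos hy) (pos hz)]

lemma IsUnitTangent.isGeodesicLine {X U : EuclideanSpace ℝ (Fin d) × ℝ} (h : IsUnitTangent X U) :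
    IsGeodesicLine fun t ↦ ofHyperboloid (hyperbolicLine X U t) := by
  have mem_ball (t : ℝ) := ofHyperboloid_mem (h.hyperbolicLine_mem t)
  refine ⟨mem_ball, fun s t ↦ ?_⟩
  rw [hdist_eq_arcosh_lorentz (mem_ball s) (mem_ball t),
    toHyperboloid_ofHyperboloid (h.hyperbolicLine_mem s),
    toHyperboloid_ofHyperboloid (h.hyperbolicLine_mem t), h.lorentz_hyperbolicLine, ← cosh_abs,
    arcosh_cosh (abs_nonneg _)]

lemma IsTotallyGeodesic.isLineClosed (hM : IsTotallyGeodesic M) :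
    IsLineClosed (toHyperboloid '' M) := by
  rintro _ ⟨x, hx, rfl⟩ _ ⟨y, hy, rfl⟩ α β hZ
  have hX := toHyperboloid_mem (hM.2.1 hx)
  have hY := toHyperboloid_mem (hM.2.1 hy)
  obtain hXY | hXY := (one_le_lorentz hX hY).eq_or_lt
  · refine ⟨x, hx, ?_⟩
    rw [← eq_of_lorentz_le_one hX hY hXY.ge, ← add_smul] at hZ ⊢
    have one_le := one_le_lorentz hX hZ
    have unit := hZ.1
    simp only [map_smul, LinearMap.smul_apply, smul_eq_mul, hX.1, mul_one] at one_le unit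
    rw [(mul_self_eq_one_iff.mp unit).resolve_right (by linarith), one_smul]
  · set r := arcosh (lorentz (toHyperboloid x) (toHyperboloid y))
    have hr : r ≠ 0 := (arcosh_pos hXY).ne'
    obtain ⟨U, hU, hUr⟩ := exists_isUnitTangent hX hY hr (cosh_arcosh hXY.le).symm
    have mem_zero : ofHyperboloid (hyperbolicLine (toHyperboloid x) U 0) ∈ M := by
      simpa [hyperbolicLine, ofHyperboloid_toHyperboloid (hM.2.1 hx)] using hx
    have mem_r : ofHyperboloid (hyperbolicLine (toHyperboloid x) U r) ∈ M := by
      rwa [hUr, ofHyperboloid_toHyperboloid (hM.2.1 hy)]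
    rw [← hUr, hyperbolicLine, smul_add, smul_smul, smul_smul, ← add_assoc, ← add_smul] at hZ ⊢
    rw [hU.eq_hyperbolicLine_arsinh hZ]
    exact ⟨_, hM.2.2 _ hU.isGeodesicLine 0 r hr.symm mem_zero mem_r _,
      toHyperboloid_ofHyperboloid (hU.hyperbolicLine_mem _)⟩

lemma IsGeodesicSegment.isSmoothPath {γ : ℝ → EuclideanSpace ℝ (Fin d)} {a b : ℝ}
    (h : IsGeodesicSegment γ a b) : IsSmoothPath γ a b := by
  refine ⟨h.1, ?_⟩
  rcases le_or_gt b a with hab | hab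
  · intro t ht
    rw [subsingleton_Icc_of_ge hab |>.eq_singleton_of_mem ht]
    exact contDiffWithinAt_singleton
  have lorentz_eq (s) (hs : s ∈ Icc a b) (t) (ht : t ∈ Icc a b) :
      lorentz (toHyperboloid (γ s)) (toHyperboloid (γ t)) = cosh (s - t) := by
    rw [← cosh_hdist (h.1 s hs) (h.1 t ht), h.2 s hs t ht, cosh_abs]
  obtain ⟨U, hU, eq_line⟩ := exists_forall_eq_hyperbolicLine
    (fun t ht ↦ toHyperboloid_mem (h.1 t ht)) lorentz_eq (left_mem_Icc.mpr hab.le)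
    (right_mem_Icc.mpr hab.le) hab.ne
  have smooth : ContDiff ℝ ∞ fun t ↦ hyperbolicLine (toHyperboloid (γ a)) U (t - a) :=
    contDiff_hyperbolicLine.comp (contDiff_id.sub contDiff_const)
  refine (contDiffOn_ofHyperboloid.comp smooth.contDiffOn fun t _ ↦
    hU.hyperbolicLine_mem (t - a)).congr fun t ht ↦ ?_
  rw [Function.comp_apply, ← eq_line t ht, ofHyperboloid_toHyperboloid (h.1 t ht)]

/-- The totally geodesic subset of the Poincaré ball that corresponds to the section of the
hyperboloid by the subspace fixed by `T`. -/
def linearSection (T : (EuclideanSpace ℝ (Fin d) × ℝ) →L[ℝ] (EuclideanSpace ℝ (Fin d) × ℝ)) :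
    Set (EuclideanSpace ℝ (Fin d)) :=
  {x ∈ ball d | T (toHyperboloid x) = toHyperboloid x}

lemma IsTotallyGeodesic.exists_eq_linearSection (hM : IsTotallyGeodesic M) :
    ∃ T, IsTimelikeProjection T ∧ M = linearSection T := by
  have subset : toHyperboloid '' M ⊆ hyperboloid _ :=
    image_subset_iff.mpr fun x hx ↦ toHyperboloid_mem (hM.2.1 hx)
  obtain ⟨P, hP⟩ := hM.1.image toHyperboloid
  obtain ⟨T, hT, fixed_iff⟩ := exists_isTimelikeProjection (Submodule.span ℝ (toHyperboloid '' M))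
    (subset hP) (Submodule.subset_span hP)
  refine ⟨T, hT, Set.ext fun x ↦ ⟨fun hx ↦ ⟨hM.2.1 hx, ?_⟩, fun ⟨hx, hTx⟩ ↦ ?_⟩⟩
  · exact (fixed_iff _).mpr (Submodule.subset_span (mem_image_of_mem _ hx))
  · obtain ⟨y, hy, hyx⟩ := hM.isLineClosed.mem_of_mem_span subset ⟨P, hP⟩ (toHyperboloid_mem hx)
      ((fixed_iff _).mp hTx)
    rwa [← toHyperboloid_injOn (hM.2.1 hy) hx hyx]

lemma IsClosestPoint.distTo_eq (h : IsClosestPoint M x y) : distTo x M = hdist x y :=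
  IsLeast.csInf_eq ⟨mem_image_of_mem _ h.1, forall_mem_image.mpr h.2⟩

namespace IsTimelikeProjection

variable {T : (EuclideanSpace ℝ (Fin d) × ℝ) →L[ℝ] (EuclideanSpace ℝ (Fin d) × ℝ)}

lemma isClosestPoint_linearSection_iff (hT : IsTimelikeProjection T) (hx : x ∈ ball d) :
    IsClosestPoint (linearSection T) x y ↔ y = ofHyperboloid (foot T (toHyperboloid x)) := by
  have hX := toHyperboloid_mem hx
  have hF := hT.foot_mem hX
  have to_foot := toHyperboloid_ofHyperboloid hF
  have foot_mem : ofHyperboloid (foot T (toHyperboloid x)) ∈ linearSection T :=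
    ⟨ofHyperboloid_mem hF, by rw [to_foot, hT.map_foot]⟩
  constructor
  · intro hy
    have hY := toHyperboloid_mem hy.1.1
    have le := hy.2 _ foot_mem
    rw [hdist_le_hdist_iff hx hy.1.1 foot_mem.1, to_foot, hT.lorentz_foot hX,
      hT.lorentz_eq_coshDist_mul hX hy.1.2, mul_le_iff_le_one_right (hT.coshDist_pos hX)] at le
    rw [eq_of_lorentz_le_one hF hY le, ofHyperboloid_toHyperboloid hy.1.1]
  · rintro rfl
    refine ⟨foot_mem, fun z hz ↦ ?_⟩
    rw [hdist_le_hdist_iff hx foot_mem.1 hz.1, to_foot, hT.lorentz_foot hX,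
      hT.lorentz_eq_coshDist_mul hX hz.2]
    exact le_mul_of_one_le_right (hT.coshDist_pos hX).le
      (one_le_lorentz hF (toHyperboloid_mem hz.1))

lemma proj_linearSection (hT : IsTimelikeProjection T) (hx : x ∈ ball d) :
    proj (linearSection T) x = ofHyperboloid (foot T (toHyperboloid x)) :=
  (hT.isClosestPoint_linearSection_iff hx).mp <|
    Classical.epsilon_spec ⟨_, (hT.isClosestPoint_linearSection_iff hx).mpr rfl⟩

lemma toHyperboloid_proj_linearSection (hT : IsTimelikeProjection T) (hx : x ∈ ball d) :
    toHyperboloid (proj (linearSection T) x) = foot T (toHyperboloid x) := by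
  rw [hT.proj_linearSection hx, toHyperboloid_ofHyperboloid (hT.foot_mem (toHyperboloid_mem hx))]

lemma cosh_distTo_linearSection (hT : IsTimelikeProjection T) (hx : x ∈ ball d) :
    cosh (distTo x (linearSection T)) = coshDist T (toHyperboloid x) := by
  have closest := (hT.isClosestPoint_linearSection_iff hx).mpr (hT.proj_linearSection hx)
  rw [closest.distTo_eq, cosh_hdist hx closest.1.1, hT.toHyperboloid_proj_linearSection hx,
    hT.lorentz_foot (toHyperboloid_mem hx)]

end IsTimelikeProjection

namespace IsTotallyGeodesic

lemma isClosestPoint_iff (hM : IsTotallyGeodesic M) (hx : x ∈ ball d) :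
    IsClosestPoint M x y ↔ y = proj M x := by
  obtain ⟨T, hT, rfl⟩ := hM.exists_eq_linearSection
  rw [hT.isClosestPoint_linearSection_iff hx, hT.proj_linearSection hx]

lemma isClosestPoint_proj (hM : IsTotallyGeodesic M) (hx : x ∈ ball d) :
    IsClosestPoint M x (proj M x) :=
  (hM.isClosestPoint_iff hx).mpr rfl

lemma proj_mem (hM : IsTotallyGeodesic M) (hx : x ∈ ball d) : proj M x ∈ M :=
  (hM.isClosestPoint_proj hx).1

lemma proj_mem_ball (hM : IsTotallyGeodesic M) (hx : x ∈ ball d) : proj M x ∈ ball d :=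
  hM.2.1 (hM.proj_mem hx)

lemma eq_proj_iff (hM : IsTotallyGeodesic M) (hx : x ∈ ball d) : x = proj M x ↔ x ∈ M := by
  refine ⟨fun h ↦ h ▸ hM.proj_mem hx, fun hxM ↦ ?_⟩
  refine (hM.isClosestPoint_iff hx).mp ⟨hxM, fun y hy ↦ ?_⟩
  rw [hdist_le_hdist_iff hx hx (hM.2.1 hy), (toHyperboloid_mem hx).1]
  exact one_le_lorentz (toHyperboloid_mem hx) (toHyperboloid_mem (hM.2.1 hy))

lemma contDiffOn_proj (hM : IsTotallyGeodesic M) {n : WithTop ℕ∞} :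
    ContDiffOn ℝ n (proj M) (ball d) := by
  obtain ⟨T, hT, rfl⟩ := hM.exists_eq_linearSection
  have mapsTo : MapsTo toHyperboloid (ball d) (hyperboloid _) := fun _ ↦ toHyperboloid_mem
  exact ((contDiffOn_ofHyperboloid.comp hT.contDiffOn_foot fun _ ↦ hT.foot_mem).comp
    contDiffOn_toHyperboloid mapsTo).congr fun x hx ↦ hT.proj_linearSection hx

lemma cosh_hdist_proj_sub_one_mul_le (hM : IsTotallyGeodesic M) (hx : x ∈ ball d)
    (hy : y ∈ ball d) :
    (cosh (hdist (proj M x) (proj M y)) - 1) * (cosh (distTo x M) * cosh (distTo y M)) ≤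
      cosh (hdist x y) - 1 := by
  have hx' := hM.proj_mem_ball hx
  have hy' := hM.proj_mem_ball hy
  rw [cosh_hdist hx' hy', cosh_hdist hx hy]
  obtain ⟨T, hT, rfl⟩ := hM.exists_eq_linearSection
  rw [hT.toHyperboloid_proj_linearSection hx, hT.toHyperboloid_proj_linearSection hy,
    hT.cosh_distTo_linearSection hx, hT.cosh_distTo_linearSection hy]
  exact hT.lorentz_foot_foot_sub_one_mul_le (toHyperboloid_mem hx) (toHyperboloid_mem hy)

lemma contDiffOn_cosh_distTo (hM : IsTotallyGeodesic M) {n : WithTop ℕ∞} :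
    ContDiffOn ℝ n (fun x ↦ cosh (distTo x M)) (ball d) := by
  obtain ⟨T, hT, rfl⟩ := hM.exists_eq_linearSection
  have mapsTo : MapsTo toHyperboloid (ball d) (hyperboloid _) := fun _ ↦ toHyperboloid_mem
  exact (hT.contDiffOn_coshDist.comp contDiffOn_toHyperboloid mapsTo).congr
    fun x hx ↦ hT.cosh_distTo_linearSection hx

lemma one_lt_cosh_distTo (hM : IsTotallyGeodesic M) (hx : x ∈ ball d) (hxM : x ∉ M) :
    1 < cosh (distTo x M) := by
  have hx' := hM.proj_mem_ball hx
  rw [(hM.isClosestPoint_proj hx).distTo_eq, cosh_hdist hx hx']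
  by_contra! h
  have := eq_of_lorentz_le_one (toHyperboloid_mem hx) (toHyperboloid_mem hx') h
  exact hxM (toHyperboloid_injOn hx hx' this ▸ hM.proj_mem hx)

end IsTotallyGeodesic

end PoincareBall

section Paths

variable {d : ℕ} {M : Set (EuclideanSpace ℝ (Fin d))} {x v w : EuclideanSpace ℝ (Fin d)}
  {γ : ℝ → EuclideanSpace ℝ (Fin d)} {s : Set ℝ} {a b t : ℝ}

lemma tangentNorm_nonneg (hx : x ∈ ball d) (v : EuclideanSpace ℝ (Fin d)) :
    0 ≤ tangentNorm x v :=
  div_nonneg (by positivity) (one_sub_norm_sq_pos hx).le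

lemma tangentNorm_zero (x : EuclideanSpace ℝ (Fin d)) : tangentNorm x 0 = 0 := by
  simp [tangentNorm]

lemma eq_zero_of_tangentNorm_nonpos (hx : x ∈ ball d) (h : tangentNorm x v ≤ 0) : v = 0 := by
  have := (div_le_iff₀ (one_sub_norm_sq_pos hx)).mp h
  exact norm_le_zero_iff.mp (by linarith)

lemma tendsto_cosh_hdist_sub_one_div_sq (hγ : HasDerivWithinAt γ v s t)
    (hs : MapsTo γ s (ball d)) (ht : t ∈ s) :
    Tendsto (fun u ↦ 2 * (cosh (hdist (γ u) (γ t)) - 1) / (u - t) ^ 2) (𝓝[s \ {t}] t)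
      (𝓝 (tangentNorm (γ t) v ^ 2)) := by
  have one_sub_pos := one_sub_norm_sq_pos (hs ht)
  have tendsto_γ : Tendsto γ (𝓝[s \ {t}] t) (𝓝 (γ t)) :=
    hγ.continuousWithinAt.tendsto.mono_left (nhdsWithin_mono t sdiff_subset)
  have tendsto_slope : Tendsto (slope γ t) (𝓝[s \ {t}] t) (𝓝 v) :=
    hasDerivWithinAt_iff_tendsto_slope.mp hγ
  have limit := ((tendsto_slope.norm.pow 2).const_mul 4).div
    (((tendsto_γ.norm.pow 2).const_sub 1).mul_const (1 - ‖γ t‖ ^ 2))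
    (mul_pos one_sub_pos one_sub_pos).ne'
  convert limit.congr' ?_ using 2
  · rw [tangentNorm]
    field_simp
    ring
  · filter_upwards [self_mem_nhdsWithin] with u hu
    have ne : u - t ≠ 0 := sub_ne_zero.mpr hu.2
    rw [Pi.div_apply, cosh_hdist (hs hu.1) (hs ht), lorentz_toHyperboloid (hs hu.1) (hs ht),
      slope_def_module, norm_smul, mul_pow, norm_eq_abs, sq_abs]
    have := one_sub_norm_sq_pos (hs hu.1)
    field_simp
    ring

lemma IsTotallyGeodesic.cosh_distTo_mul_tangentNorm_proj_le (hM : IsTotallyGeodesic M)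
    (hγ : HasDerivWithinAt γ v s t) (hπγ : HasDerivWithinAt (fun u ↦ proj M (γ u)) w s t)
    (hs : MapsTo γ s (ball d)) (ht : t ∈ s) (hst : UniqueDiffWithinAt ℝ s t) :
    cosh (distTo (γ t) M) * tangentNorm (proj M (γ t)) w ≤ tangentNorm (γ t) v := by
  have hπ : MapsTo (fun u ↦ proj M (γ u)) s (ball d) := fun u hu ↦ hM.proj_mem_ball (hs hu)
  have : (𝓝[s \ {t}] t).NeBot := by
    rwa [← accPt_principal_iff_nhdsWithin, ← uniqueDiffWithinAt_iff_accPt]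
  have tendsto_cosh : Tendsto (fun u ↦ cosh (distTo (γ u) M)) (𝓝[s \ {t}] t)
      (𝓝 (cosh (distTo (γ t) M))) :=
    (((hM.contDiffOn_cosh_distTo (n := 0)).continuousOn _ (hs ht)).tendsto.comp
      (hγ.continuousWithinAt.tendsto_nhdsWithin hs)).mono_left (nhdsWithin_mono t sdiff_subset)
  have sq_le := le_of_tendsto_of_tendsto
    ((tendsto_cosh_hdist_sub_one_div_sq hπγ hπ ht).mul
      (tendsto_cosh.mul_const (cosh (distTo (γ t) M))))
    (tendsto_cosh_hdist_sub_one_div_sq hγ hs ht) <| by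
      filter_upwards [self_mem_nhdsWithin] with u hu
      rw [div_mul_eq_mul_div, mul_assoc]
      gcongr
      exact hM.cosh_hdist_proj_sub_one_mul_le (hs hu.1) (hs ht)
  refine le_of_sq_le_sq ?_ (tangentNorm_nonneg (hs ht) v)
  linarith

lemma norm_eq_norm_left_of_eq_zero_or_derivWithin_eq_zero {E : Type*} [NormedAddCommGroup E]
    [InnerProductSpace ℝ E] {f : ℝ → E} (hf : DifferentiableOn ℝ f (Icc a b))
    (h : ∀ t ∈ Icc a b, f t = 0 ∨ derivWithin f (Icc a b) t = 0) (ht : t ∈ Icc a b) :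
    ‖f t‖ = ‖f a‖ := by
  have norm_sq_deriv (u) (hu : u ∈ Icc a b) :
      HasDerivWithinAt (fun u ↦ ‖f u‖ ^ 2) 0 (Icc a b) u := by
    refine (hf u hu).hasDerivWithinAt.norm_sq.congr_deriv ?_
    rcases h u hu with h | h <;> simp [h]
  have norm_sq_eq := constant_of_derivWithin_zero
    (fun u hu ↦ (norm_sq_deriv u hu).differentiableWithinAt)
    (fun u hu ↦ (norm_sq_deriv u (Ico_subset_Icc_self hu)).derivWithin
      (uniqueDiffOn_Icc (hu.1.trans_lt hu.2) u (Ico_subset_Icc_self hu))) t ht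
  exact (sq_eq_sq₀ (norm_nonneg _) (norm_nonneg _)).mp norm_sq_eq

namespace IsSmoothPath

lemma proj (hγ : IsSmoothPath γ a b) (hM : IsTotallyGeodesic M) :
    IsSmoothPath (fun t ↦ Hyp.proj M (γ t)) a b :=
  ⟨fun t ht ↦ hM.proj_mem_ball (hγ.1 t ht), hM.contDiffOn_proj.comp hγ.2 hγ.1⟩

lemma hasDerivWithinAt (hγ : IsSmoothPath γ a b) (ht : t ∈ Icc a b) :
    HasDerivWithinAt γ (derivWithin γ (Icc a b) t) (Icc a b) t :=
  (hγ.2.differentiableOn (by simp) t ht).hasDerivWithinAt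

lemma continuousOn_tangentNorm (hγ : IsSmoothPath γ a b) (hab : a < b) :
    ContinuousOn (fun t ↦ tangentNorm (γ t) (derivWithin γ (Icc a b) t)) (Icc a b) :=
  (continuousOn_const.mul
    (hγ.2.continuousOn_derivWithin (uniqueDiffOn_Icc hab) (by simp)).norm).div
    (continuousOn_const.sub (hγ.2.continuousOn.norm.pow 2))
    fun t ht ↦ (one_sub_norm_sq_pos (hγ.1 t ht)).ne'

lemma length_nonneg (hγ : IsSmoothPath γ a b) (hab : a ≤ b) : 0 ≤ length γ a b :=
  intervalIntegral.integral_nonneg hab fun t ht ↦ tangentNorm_nonneg (hγ.1 t ht) _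

lemma cosh_distTo_mul_tangentNorm_proj_le (hγ : IsSmoothPath γ a b) (hM : IsTotallyGeodesic M)
    (hab : a < b) (ht : t ∈ Icc a b) :
    cosh (distTo (γ t) M) *
        tangentNorm (Hyp.proj M (γ t)) (derivWithin (fun u ↦ Hyp.proj M (γ u)) (Icc a b) t) ≤
      tangentNorm (γ t) (derivWithin γ (Icc a b) t) :=
  hM.cosh_distTo_mul_tangentNorm_proj_le (hγ.hasDerivWithinAt ht)
    ((hγ.proj hM).hasDerivWithinAt ht) hγ.1 ht (uniqueDiffOn_Icc hab t ht)

lemma length_proj_le (hγ : IsSmoothPath γ a b) (hM : IsTotallyGeodesic M) (hab : a ≤ b) {r : ℝ}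
    (hr : 0 ≤ r) (hγM : ∀ t ∈ Icc a b, r ≤ distTo (γ t) M) :
    length (fun t ↦ Hyp.proj M (γ t)) a b ≤ 1 / cosh r * length γ a b := by
  rcases hab.eq_or_lt with rfl | hab'
  · simp [length]
  rw [length, length, ← intervalIntegral.integral_const_mul]
  refine intervalIntegral.integral_mono_on hab
    (((hγ.proj hM).continuousOn_tangentNorm hab').intervalIntegrable_of_Icc hab)
    ((continuousOn_const.mul
      (hγ.continuousOn_tangentNorm hab')).intervalIntegrable_of_Icc hab) fun t ht ↦ ?_
  have cosh_le : cosh r ≤ cosh (distTo (γ t) M) :=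
    cosh_strictMonoOn.monotoneOn hr (hr.trans (hγM t ht)) (hγM t ht)
  rw [one_div_mul_eq_div, le_div_iff₀' (cosh_pos r)]
  exact (mul_le_mul_of_nonneg_right cosh_le (tangentNorm_nonneg ((hγ.proj hM).1 t ht) _)).trans
    (hγ.cosh_distTo_mul_tangentNorm_proj_le hM hab' ht)

lemma eq_left_of_derivWithin_eq_zero_off (hγ : IsSmoothPath γ a b) (hM : IsTotallyGeodesic M)
    (hab : a < b) (hstat : ∀ t ∈ Icc a b, γ t ∉ M → derivWithin γ (Icc a b) t = 0)
    (hoff : ∃ t ∈ Icc a b, γ t ∉ M) (ht : t ∈ Icc a b) : γ t = γ a := by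
  have mem_iff (u) (hu : u ∈ Icc a b) : γ u - Hyp.proj M (γ u) = 0 ↔ γ u ∈ M := by
    rw [sub_eq_zero, hM.eq_proj_iff (hγ.1 u hu)]
  have stationary (u) (hu : u ∈ Icc a b) : γ u - Hyp.proj M (γ u) = 0 ∨
      derivWithin (fun u ↦ γ u - Hyp.proj M (γ u)) (Icc a b) u = 0 := by
    rw [mem_iff u hu]
    refine or_iff_not_imp_left.mpr fun huM ↦ ?_
    have γ_stat := hstat u hu huM
    have proj_stat : derivWithin (fun u ↦ Hyp.proj M (γ u)) (Icc a b) u = 0 := by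
      have le := hγ.cosh_distTo_mul_tangentNorm_proj_le hM hab hu
      rw [γ_stat, tangentNorm_zero] at le
      exact eq_zero_of_tangentNorm_nonpos ((hγ.proj hM).1 u hu)
        (nonpos_of_mul_nonpos_right le (cosh_pos _))
    rw [derivWithin_fun_sub (hγ.hasDerivWithinAt hu).differentiableWithinAt
      ((hγ.proj hM).hasDerivWithinAt hu).differentiableWithinAt, γ_stat, proj_stat, sub_zero]
  have norm_eq (u) (hu : u ∈ Icc a b) := norm_eq_norm_left_of_eq_zero_or_derivWithin_eq_zero
    ((hγ.2.sub (hγ.proj hM).2).differentiableOn (by simp)) stationary hu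
  obtain ⟨t₀, ht₀, ht₀M⟩ := hoff
  have always_off (u) (hu : u ∈ Icc a b) : γ u ∉ M := fun huM ↦ ht₀M <| by
    rw [← mem_iff u hu, ← norm_eq_zero, norm_eq u hu, ← norm_eq t₀ ht₀, norm_eq_zero,
      mem_iff t₀ ht₀] at huM
    exact huM
  exact constant_of_derivWithin_zero (hγ.2.differentiableOn (by simp))
    (fun u hu ↦ hstat u (Ico_subset_Icc_self hu) (always_off u (Ico_subset_Icc_self hu))) t ht

lemma length_proj_lt (hγ : IsSmoothPath γ a b) (hM : IsTotallyGeodesic M)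
    (hne : ∃ s ∈ Icc a b, ∃ t ∈ Icc a b, γ s ≠ γ t) (hoff : ∃ t ∈ Icc a b, γ t ∉ M) :
    length (fun t ↦ Hyp.proj M (γ t)) a b < length γ a b := by
  obtain ⟨s, hs, t, ht, hst⟩ := hne
  have hab : a < b := by
    by_contra! hba
    exact hst (congrArg γ (subsingleton_Icc_of_ge hba hs ht))
  have speed_nonneg {u} (hu : u ∈ Icc a b) := tangentNorm_nonneg ((hγ.proj hM).1 u hu)
    (derivWithin (fun u ↦ Hyp.proj M (γ u)) (Icc a b) u)
  have speed_le {u} (hu : u ∈ Icc a b) := hγ.cosh_distTo_mul_tangentNorm_proj_le hM hab hu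
  refine intervalIntegral.integral_lt_integral_of_continuousOn_of_le_of_exists_lt hab
    ((hγ.proj hM).continuousOn_tangentNorm hab) (hγ.continuousOn_tangentNorm hab)
    (fun u hu ↦ (le_mul_of_one_le_left (speed_nonneg (Ioc_subset_Icc_self hu))
      (one_le_cosh _)).trans (speed_le (Ioc_subset_Icc_self hu))) ?_
  by_contra! speed_ge
  have stationary (u) (hu : u ∈ Icc a b) (huM : γ u ∉ M) : derivWithin γ (Icc a b) u = 0 := by
    have one_lt := hM.one_lt_cosh_distTo (hγ.1 u hu) huM
    have proj_speed_nonpos := not_lt.mp fun pos ↦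
      ((speed_le hu).trans (speed_ge u hu)).not_gt (lt_mul_of_one_lt_left pos one_lt)
    exact eq_zero_of_tangentNorm_nonpos (hγ.1 u hu) ((speed_ge u hu).trans proj_speed_nonpos)
  have eq_left {u} := hγ.eq_left_of_derivWithin_eq_zero_off hM hab stationary hoff (t := u)
  exact hst ((eq_left hs).trans (eq_left ht).symm)

end IsSmoothPath

lemma one_div_cosh_le (r : ℝ) : 1 / cosh r ≤ 2 * exp (-r) := by
  rw [div_le_iff₀ (cosh_pos r), cosh_eq]
  have : exp (-r) * exp r = 1 := by rw [← exp_add, neg_add_cancel, exp_zero]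
  linarith [sq_nonneg (exp (-r))]

end Paths

end Hyp

theorem mainTheorem2 (d : ℕ) (M : Set (EuclideanSpace ℝ (Fin d)))
    (hM : Hyp.IsTotallyGeodesic M) :
    -- the closest-point projection is well defined
    (∀ x ∈ Hyp.ball d, Hyp.IsClosestPoint M x (Hyp.proj M x) ∧
      ∀ y, Hyp.IsClosestPoint M x y → y = Hyp.proj M x) ∧
    ∀ (a b : ℝ), a ≤ b → ∀ γ : ℝ → EuclideanSpace ℝ (Fin d),
      (Hyp.IsSmoothPath γ a b ∨ Hyp.IsGeodesicSegment γ a b) →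
        -- the path and its projection are smooth, so that both lengths make sense
        Hyp.IsSmoothPath γ a b ∧ Hyp.IsSmoothPath (fun t => Hyp.proj M (γ t)) a b ∧
        -- the bound, and its exponential form
        (∀ r : ℝ, 0 ≤ r → (∀ t ∈ Set.Icc a b, r ≤ Hyp.distTo (γ t) M) →
          Hyp.length (fun t => Hyp.proj M (γ t)) a b ≤ 1 / Real.cosh r * Hyp.length γ a b ∧
          Hyp.length (fun t => Hyp.proj M (γ t)) a b ≤
            2 * Real.exp (-r) * Hyp.length γ a b) ∧
        -- strict decrease for a non-constant path that is not contained in `M`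
        ((∃ s ∈ Set.Icc a b, ∃ t ∈ Set.Icc a b, γ s ≠ γ t) →
          (∃ t ∈ Set.Icc a b, γ t ∉ M) →
            Hyp.length (fun t => Hyp.proj M (γ t)) a b < Hyp.length γ a b) := by
  refine ⟨fun x hx ↦ ⟨hM.isClosestPoint_proj hx, fun y ↦ (hM.isClosestPoint_iff hx).mp⟩,
    fun a b hab γ hγ ↦ ?_⟩
  have smooth : Hyp.IsSmoothPath γ a b := hγ.elim id Hyp.IsGeodesicSegment.isSmoothPath
  refine ⟨smooth, smooth.proj hM, fun r hr hγM ↦ ?_, smooth.length_proj_lt hM⟩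
  have length_le := smooth.length_proj_le hM hab hr hγM
  exact ⟨length_le, length_le.trans <|
    mul_le_mul_of_nonneg_right (Hyp.one_div_cosh_le r) (smooth.length_nonneg hab)⟩
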